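/- **Theorem.** The bounded-error quantum query complexity of undirected $st$-connectivity is $\Omega(n)$, where $n$ is the number of vertices, both in the sorted adjacency array model and in the quantum walk model. Precisely: Inputs are undirected graphs $G$ on the ordered vertex set $X$, $|X|=n$, without isolated vertices, together with two vertices $s,t\in X$; the task is to decide whether $s$ and $t$ lie in the same connected component of $G$. Let $N(u)$ be the neighbourhood of $u$, $d_u=|N(u)|$, and let $v_1(u)<\dots<v_{d_u}(u)$ be the neighbours of $u$ in increasing order. Let $0$ in a vertex register denote a null symbol outside $X$. The graph is accessed through * (sorted adjacency array model) the degree and neighbour oracles $\mathcal O_D:|0\rangle|u\rangle\mapsto|d_u\rangle|u\rangle$ and $\mathcal O_N:|u\rangle|i\rangle|0\rangle\mapsto|u\rangle|i\rangle|v_i(u)\rangle$ for $1\le i\le d_u$; or * (quantum walk model) the oracle $\mathcal O_W:|u\rangle|0\rangle\mapsto\frac1{\sqrt{d_u}}\sum_{v\in N(u)}|u\rangle|v\rangle$. On the remaining states the oracles are extended to unitaries by an arbitrary fixed convention of the form $\sum_u|u\rangle\langle u|\otimes C_{u,N(u)}$, where the unitary $C_{u,N(u)}$ is determined by $u$ and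 $N(u)$. An algorithm knows $n$, $s$, $t$ and the convention; it has a workspace of arbitrary finite dimension, alternates arbitrary input-independent unitaries with queries, where a query applies (possibly controlled, in superposition) an oracle or its inverse, and ends with a measurement in the standard basis. Then for every $\varepsilon<1/2$ there are $c>0$ and $n_0$ such that, for each of the two models, for all $n\ge n_0$ and every convention, every quantum algorithm that decides the problem with error probability at most $\varepsilon$ on all inputs with $n$ vertices makes at least $c\,n$ queries for some pair $s,t$. The constants $c$ and $n_0$ do not depend on the convention. -/

import Mathlib

open scoped Kronecker

namespace QuantumUSTCON

/-! ### Quantum query algorithms -/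

/-- The controlled query operator `|0⟩⟨0| ⊗ 1 + |1⟩⟨1| ⊗ M + |2⟩⟨2| ⊗ Mᴴ`: depending on a control
register (the second component) the oracle `M`, its inverse, or nothing is applied. -/
noncomputable def controlled {Q : Type} [DecidableEq Q] (M : Matrix Q Q ℂ) :
    Matrix (Q × Fin 3) (Q × Fin 3) ℂ :=
  Matrix.blockDiagonal ![1, M, M.conjTranspose]

/-- A quantum query algorithm whose oracle acts on the space `ℂ^Q`. It acts on a query register
`Q`, a control register `Fin 3` and a workspace of arbitrary finite dimension `w`, starts in a
basis state, alternates arbitrary oracle-independent unitaries `U 0, …, U queries` with `queries`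
applications of the (controlled, possibly inverted) oracle, and finally measures in the standard
basis, accepting when the outcome lies in `accept`. -/
structure QueryAlgorithm (Q : Type) [Fintype Q] [DecidableEq Q] where
  /-- number of queries -/
  queries : ℕ
  /-- dimension of the workspace -/
  w : ℕ
  /-- initial basis state -/
  start : (Q × Fin 3) × Fin w
  /-- `U k` is applied after the `k`-th query; only `U 0, …, U queries` are used -/
  U : ℕ → Matrix.unitaryGroup ((Q × Fin 3) × Fin w) ℂ
  /-- accepting measurement outcomes -/
  accept : Finset ((Q × Fin 3) × Fin w)

/-- The state of the algorithm after `k` queries to the oracle `M` (and after `U k`). -/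
noncomputable def QueryAlgorithm.state {Q : Type} [Fintype Q] [DecidableEq Q]
    (A : QueryAlgorithm Q) (M : Matrix Q Q ℂ) : ℕ → ((Q × Fin 3) × Fin A.w → ℂ)
  | 0 => Matrix.mulVec (A.U 0).1 (Pi.single A.start 1)
  | k + 1 => Matrix.mulVec (A.U (k + 1)).1
      (Matrix.mulVec (controlled M ⊗ₖ (1 : Matrix (Fin A.w) (Fin A.w) ℂ)) (A.state M k))

/-- The probability that the algorithm accepts when run with the oracle `M`. -/
noncomputable def QueryAlgorithm.acceptProb {Q : Type} [Fintype Q] [DecidableEq Q]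
    (A : QueryAlgorithm Q) (M : Matrix Q Q ℂ) : ℝ :=
  ∑ b ∈ A.accept, ‖A.state M A.queries b‖ ^ 2

/-! ### Access to a graph on the ordered vertex set `Fin n` -/

open Classical in
/-- The neighbourhood `N(u)`. -/
noncomputable def nbhd {n : ℕ} (G : SimpleGraph (Fin n)) (u : Fin n) : Finset (Fin n) :=
  G.neighborFinset u

/-- The uniform superposition `|S|^{-1/2} ∑_{v ∈ S} |v⟩` over a set of vertices, in a register
with basis `X ∪ {0}`, where the null symbol `0 ∉ X` is `none`. -/
noncomputable def uniformState {n : ℕ} (S : Finset (Fin n)) : Option (Fin n) → ℂ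
  | none => 0
  | some v => if v ∈ S then (((Real.sqrt (S.card : ℝ))⁻¹ : ℝ) : ℂ) else 0

/-- A convention for the quantum walk oracle. The defining property
`|u⟩|0⟩ ↦ d_u^{-1/2} ∑_{v ∈ N(u)} |u⟩|v⟩` determines the oracle only on the states `|u⟩|0⟩`; a
convention extends it to a unitary `∑_u |u⟩⟨u| ⊗ op u N(u)`, where `op u N(u)` is any unitary
determined by `u` and `N(u)` that has the defining property. -/
structure WalkOracle (n : ℕ) where
  /-- the unitary applied to the second register when the first one holds `u` and `N(u) = S` -/
  op : Fin n → Finset (Fin n) → Matrix (Option (Fin n)) (Option (Fin n)) ℂ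
  unitary : ∀ u S, op u S ∈ Matrix.unitaryGroup (Option (Fin n)) ℂ
  spec : ∀ (u : Fin n) (S : Finset (Fin n)), S.Nonempty →
    Matrix.mulVec (op u S) (Pi.single none 1) = uniformState S

/-- The quantum walk oracle of `G`; the basis state `|u⟩|z⟩` has the index `(z, u)`. -/
noncomputable def WalkOracle.query {n : ℕ} (O : WalkOracle n) (G : SimpleGraph (Fin n)) :
    Matrix (Option (Fin n) × Fin n) (Option (Fin n) × Fin n) ℂ :=
  Matrix.blockDiagonal fun u => O.op u (nbhd G u)

/-- A convention for the oracles of the sorted adjacency array model: the degree query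
`|0⟩|u⟩ ↦ |d_u⟩|u⟩` and, for `i ∈ {1, …, d_u}`, the neighbour query
`|u⟩|i⟩|0⟩ ↦ |u⟩|i⟩|v_i(u)⟩`, where `v_1(u) < … < v_{d_u}(u)` are the neighbours of `u` in
increasing order. On the remaining states a convention extends these to any unitaries that are
block diagonal in `u`, with blocks determined by `u` and `N(u)`. -/
structure SortedArrayOracle (n : ℕ) where
  /-- the unitary applied to the degree register when the vertex is `u` and `N(u) = S` -/
  degOp : Fin n → Finset (Fin n) → Matrix (Fin (n + 1)) (Fin (n + 1)) ℂ
  /-- the unitary applied to the index and target registers when the vertex is `u`, `N(u) = S` -/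
  nbrOp : Fin n → Finset (Fin n) →
    Matrix (Fin (n + 1) × Option (Fin n)) (Fin (n + 1) × Option (Fin n)) ℂ
  deg_unitary : ∀ u S, degOp u S ∈ Matrix.unitaryGroup (Fin (n + 1)) ℂ
  nbr_unitary : ∀ u S, nbrOp u S ∈ Matrix.unitaryGroup (Fin (n + 1) × Option (Fin n)) ℂ
  deg_spec : ∀ (u : Fin n) (S : Finset (Fin n)) (d : Fin (n + 1)), (d : ℕ) = S.card →
    Matrix.mulVec (degOp u S) (Pi.single 0 1) = Pi.single d 1
  nbr_spec : ∀ (u : Fin n) (S : Finset (Fin n)) (j : Fin S.card) (i : Fin (n + 1)),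
    (i : ℕ) = j + 1 →
    Matrix.mulVec (nbrOp u S) (Pi.single (i, none) 1) =
      Pi.single (i, some (S.orderEmbOfFin rfl j)) 1

/-- The joint oracle of the sorted adjacency array model: on the direct sum of the two query
spaces, a query is a degree query on the first summand and a neighbour query on the second. -/
noncomputable def SortedArrayOracle.query {n : ℕ} (O : SortedArrayOracle n)
    (G : SimpleGraph (Fin n)) :
    Matrix ((Fin (n + 1) × Fin n) ⊕ ((Fin (n + 1) × Option (Fin n)) × Fin n))
      ((Fin (n + 1) × Fin n) ⊕ ((Fin (n + 1) × Option (Fin n)) × Fin n)) ℂ :=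
  Matrix.fromBlocks
    (Matrix.blockDiagonal fun u => O.degOp u (nbhd G u)) 0
    0 (Matrix.blockDiagonal fun u => O.nbrOp u (nbhd G u))

/-! ### Undirected `st`-connectivity -/

/-- The algorithms `A s t` decide, with error probability at most `ε`, whether `s` and `t` lie in
the same connected component of a graph `G` on `n` vertices without isolated vertices, when `G` is
accessed through `oracle G`. The vertices `s` and `t` are known to the algorithm. -/
def DecidesUSTCON {n : ℕ} {Q : Type} [Fintype Q] [DecidableEq Q]
    (oracle : SimpleGraph (Fin n) → Matrix Q Q ℂ) (ε : ℝ)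
    (A : Fin n → Fin n → QueryAlgorithm Q) : Prop :=
  ∀ G : SimpleGraph (Fin n), (∀ u, (nbhd G u).Nonempty) → ∀ s t : Fin n,
    (G.Reachable s t → 1 - ε ≤ (A s t).acceptProb (oracle G)) ∧
    (¬ G.Reachable s t → (A s t).acceptProb (oracle G) ≤ ε)

/-! ### Conventions for the oracles exist -/

theorem permMatrix_mem_unitary {m : Type} [Fintype m] [DecidableEq m] (e : Equiv.Perm m) :
    (e.permMatrix ℂ) ∈ Matrix.unitaryGroup m ℂ := by
  rw [Matrix.mem_unitaryGroup_iff, Matrix.star_eq_conjTranspose, Matrix.conjTranspose_permMatrix,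
    ← Matrix.permMatrix_mul]
  simp

theorem permMatrix_mulVec_single {m : Type} [Fintype m] [DecidableEq m] (e : Equiv.Perm m) (a : m) :
    Matrix.mulVec (e.permMatrix ℂ) (Pi.single a 1) = Pi.single (e⁻¹ a) 1 := by
  ext b
  simp [Equiv.Perm.permMatrix, PEquiv.toMatrix_apply, Pi.single_apply, Equiv.eq_symm_apply, eq_comm]

/-- The usual reversible array oracles (permutations of basis states) are such a convention. -/
theorem SortedArrayOracle.nonempty (n : ℕ) : Nonempty (SortedArrayOracle n) := by
  classical
  refine ⟨{ degOp := fun u S => (Equiv.swap 0 (Fin.ofNat (n+1) S.card)).permMatrix ℂ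
            nbrOp := fun u S => (Equiv.Perm.permMatrix ℂ (Equiv.prodCongrRight (fun i : Fin (n+1) =>
              Equiv.swap none (if h : ∃ j : Fin S.card, (i:ℕ) = j + 1 then some (S.orderEmbOfFin rfl h.choose) else none)) : Equiv.Perm (Fin (n+1) × Option (Fin n))))
            deg_unitary := fun _ _ => permMatrix_mem_unitary _
            nbr_unitary := fun _ _ => permMatrix_mem_unitary _
            deg_spec := ?_
            nbr_spec := ?_ }⟩
  · intro u S d h
    rw [permMatrix_mulVec_single]
    congr 1
    have : d = Fin.ofNat (n+1) S.card := by
      apply Fin.ext; simp [← h]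
    simp [this]
  · intro u S j i h
    rw [permMatrix_mulVec_single]
    congr 1
    have hex : ∃ j : Fin S.card, (i:ℕ) = j + 1 := ⟨j, h⟩
    have : hex.choose = j := by
      have := hex.choose_spec; apply Fin.ext; omega
    rw [Equiv.Perm.inv_eq_iff_eq]
    simp [Equiv.prodCongrRight, hex, this]

/-- The reflection exchanging `|0⟩` with the superposition over `N(u)` is such a convention. -/
theorem WalkOracle.nonempty (n : ℕ) : Nonempty (WalkOracle n) := by
  classical
  let v : Finset (Fin n) → Option (Fin n) → ℂ := fun S => Pi.single none 1 - uniformState S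
  have hs : ∀ S : Finset (Fin n), star (uniformState S) = uniformState S := by
    intro S; ext o; cases o <;> simp [uniformState]; split_ifs <;> simp
  have hu : ∀ S : Finset (Fin n), S.Nonempty → uniformState S ⬝ᵥ uniformState S = 1 := by
    intro S h
    have hc : (S.card : ℝ) ≠ 0 := by simpa using h.ne_empty
    simp only [dotProduct, Fintype.sum_option, uniformState]
    simp only [mul_zero, zero_add, mul_ite, ite_mul, zero_mul, Finset.sum_ite_mem, Finset.univ_inter]
    simp only [← Complex.ofReal_mul, ← mul_inv, Real.mul_self_sqrt (Nat.cast_nonneg S.card)]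
    simp
    field_simp
    simp_all
  have hv : ∀ S : Finset (Fin n), S.Nonempty → v S ⬝ᵥ v S = 2 := by
    intro S h
    simp [v, sub_dotProduct, dotProduct_sub, hu S h]
    simp [uniformState]; norm_num
  have hvs : ∀ S, star (v S) = v S := by
    intro S; ext o
    have := congrFun (hs S) o
    simp [v, Pi.single_apply] at this ⊢
    exact this
  refine ⟨{ op := fun u S => if S.Nonempty then 1 - Matrix.vecMulVec (v S) (v S) else 1
            unitary := ?_
            spec := ?_ }⟩
  · intro u S
    by_cases h : S.Nonempty
    · simp only [h, if_true]
      rw [Matrix.mem_unitaryGroup_iff, Matrix.star_eq_conjTranspose, Matrix.conjTranspose_sub, Matrix.conjTranspose_one, Matrix.conjTranspose_vecMulVec, hvs, sub_mul, mul_sub, mul_sub, Matrix.vecMulVec_mul_vecMulVec, hv S h]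
      simp [two_smul, Matrix.vecMulVec_add]
    · simp [h, one_mem]
  · intro u S h
    simp only [h, if_true, Matrix.sub_mulVec, Matrix.one_mulVec, Matrix.vecMulVec_mulVec]
    ext o; simp [v]; simp [uniformState]
end QuantumUSTCON

namespace QuantumUSTCON

/-! ### Sums of juntas -/

/-! Reduction from parity by the polynomial method. In a two-row ladder, bit `c` of `S` decides
whether the edges between columns `c` and `c + 1` cross. Each crossing swaps rows, so the row-0
vertices of columns `0` and `k` are connected iff the number of crossings among the first `k` gaps
is even (`ladder_reachable_iff`). A neighbourhood sees only two bits (`nbhd_ladder_inter`), so under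
every convention each oracle entry is a function of two bits; nothing else about the oracle is used.
After `q` queries, amplitudes are sums of functions of at most `2 * q` bits, and the acceptance
probability one of functions of at most `4 * q` bits (`QueryAlgorithm.acceptProb_mem_juntaSpan`).
Such a sum is orthogonal to parity on more than `4 * q` bits, whereas bounded error forces
correlation (`le_of_approximates_parity`). With `k = n / 2 - 1` this gives `n / 2 - 1 ≤ 4 * q`. -/

/-- The span of the functions on finite sets of bits that depend on at most `d` bits. -/
def juntaSpan (d : ℕ) : Submodule ℂ (Finset ℕ → ℂ) :=
  Submodule.span ℂ {f | ∃ D : Finset ℕ, D.card ≤ d ∧ ∀ S, f S = f (S ∩ D)}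

theorem mem_juntaSpan {d : ℕ} {f : Finset ℕ → ℂ} (D : Finset ℕ) (hD : D.card ≤ d)
    (hf : ∀ S, f S = f (S ∩ D)) : f ∈ juntaSpan d :=
  Submodule.subset_span ⟨D, hD, hf⟩

theorem const_mem_juntaSpan (d : ℕ) (a : ℂ) : (fun _ => a) ∈ juntaSpan d :=
  mem_juntaSpan ∅ (by simp) fun _ => rfl

theorem mul_mem_juntaSpan {d e : ℕ} {f g : Finset ℕ → ℂ} (hf : f ∈ juntaSpan d)
    (hg : g ∈ juntaSpan e) : (fun S => f S * g S) ∈ juntaSpan (d + e) := by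
  have h : f * g ∈ juntaSpan d * juntaSpan e := Submodule.mul_mem_mul hf hg
  rw [juntaSpan, juntaSpan, Submodule.span_mul_span] at h
  refine Submodule.span_mono ?_ h
  rintro _ ⟨f, ⟨D, hD, hf⟩, g, ⟨E, hE, hg⟩, rfl⟩
  refine ⟨D ∪ E, (Finset.card_union_le _ _).trans (add_le_add hD hE), fun S => ?_⟩
  simp only [Pi.mul_apply]
  rw [hf S, hg S, hf (S ∩ (D ∪ E)), hg (S ∩ (D ∪ E)), Finset.inter_assoc, Finset.inter_assoc,
    Finset.inter_eq_right.2 Finset.subset_union_left,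
    Finset.inter_eq_right.2 Finset.subset_union_right]

theorem sum_mem_juntaSpan {d : ℕ} {ι : Type*} (s : Finset ι) {f : ι → Finset ℕ → ℂ}
    (hf : ∀ i ∈ s, f i ∈ juntaSpan d) : (fun S => ∑ i ∈ s, f i S) ∈ juntaSpan d := by
  convert Submodule.sum_mem (juntaSpan d) hf using 1
  ext S
  simp

theorem conj_mem_juntaSpan {d : ℕ} {f : Finset ℕ → ℂ} (hf : f ∈ juntaSpan d) :
    (fun S => star (f S)) ∈ juntaSpan d := by
  induction hf using Submodule.span_induction with
  | mem f hf =>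
    obtain ⟨D, hD, hf⟩ := hf
    exact mem_juntaSpan D hD fun S => by rw [hf S]
  | zero => simpa using const_mem_juntaSpan d 0
  | add f g _ _ hf hg =>
    convert Submodule.add_mem _ hf hg using 1
    ext S
    simp
  | smul a f _ hf =>
    convert Submodule.smul_mem _ (star a) hf using 1
    ext S
    simp

/-- A sum of juntas on fewer than `k` bits is orthogonal to the parity of `k` bits. -/
theorem sum_parity_mul_eq_zero {d k : ℕ} (hdk : d < k) {f : Finset ℕ → ℂ}
    (hf : f ∈ juntaSpan d) : ∑ S ∈ (Finset.range k).powerset, (-1 : ℂ) ^ S.card * f S = 0 := by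
  induction hf using Submodule.span_induction with
  | mem f hf =>
    obtain ⟨D, hD, hf⟩ := hf
    -- Toggling a bit `i` that `f` ignores flips the sign and keeps the value, so the terms cancel
    -- in pairs.
    obtain ⟨i, hi, hiD⟩ : ∃ i ∈ Finset.range k, i ∉ D :=
      Finset.exists_mem_notMem_of_card_lt_card (by simpa using hD.trans_lt hdk)
    rw [← Finset.insert_erase hi, Finset.sum_powerset_insert (Finset.notMem_erase i _),
      ← Finset.sum_add_distrib]
    refine Finset.sum_eq_zero fun S hS => ?_
    have hiS : i ∉ S := fun h => Finset.notMem_erase i _ (Finset.mem_powerset.1 hS h)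
    rw [Finset.card_insert_of_notMem hiS, hf (insert i S), Finset.insert_inter_of_notMem hiD,
      ← hf S]
    ring
  | zero => simp
  | add f g _ _ hf hg => simp [mul_add, Finset.sum_add_distrib, hf, hg]
  | smul a f _ hf => simp [mul_left_comm _ a, ← Finset.mul_sum, hf]

/-- A sum of juntas that approximates the parity of `k` bits involves at least `k` bits. -/
theorem le_of_approximates_parity {d k : ℕ} {ε : ℝ} (hε : ε < 1 / 2) {p : Finset ℕ → ℝ}
    (hp : (fun S => (p S : ℂ)) ∈ juntaSpan d)
    (heven : ∀ S ⊆ Finset.range k, Even S.card → 1 - ε ≤ p S)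
    (hodd : ∀ S ⊆ Finset.range k, ¬ Even S.card → p S ≤ ε) : k ≤ d := by
  by_contra! hdk
  -- Centring at `1 / 2` stays in the span and makes every signed term at least `1 / 2 - ε > 0`.
  have h := sum_parity_mul_eq_zero hdk
    (Submodule.sub_mem _ hp (const_mem_juntaSpan d ((1 / 2 : ℝ) : ℂ)))
  simp only [Pi.sub_apply] at h
  have h' : ∑ S ∈ (Finset.range k).powerset, (-1 : ℝ) ^ S.card * (p S - 1 / 2) = 0 := by
    exact_mod_cast h
  refine (Finset.sum_pos (fun S hS => ?_) ⟨∅, by simp⟩).ne' h'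
  rw [Finset.mem_powerset] at hS
  by_cases hc : Even S.card
  · rw [hc.neg_one_pow]
    linarith [heven S hS hc]
  · rw [(Nat.not_even_iff_odd.1 hc).neg_one_pow]
    linarith [hodd S hS hc]

/-! ### The polynomial method -/

/-- Inverse queries cost no extra degree, since conjugation preserves the set of relevant bits. -/
theorem controlled_mem_juntaSpan {Q : Type} [DecidableEq Q] {M : Finset ℕ → Matrix Q Q ℂ}
    {d : ℕ} (hM : ∀ i j, (fun S => M S i j) ∈ juntaSpan d) (i j : Q × Fin 3) :
    (fun S => controlled (M S) i j) ∈ juntaSpan d := by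
  obtain ⟨i, a⟩ := i
  obtain ⟨j, b⟩ := j
  by_cases hab : a = b
  · subst hab
    simp only [controlled, Matrix.blockDiagonal_apply_eq]
    fin_cases a
    · exact const_mem_juntaSpan d _
    · exact hM i j
    · exact conj_mem_juntaSpan (hM j i)
  · simpa only [controlled, Matrix.blockDiagonal_apply_ne _ _ _ hab] using const_mem_juntaSpan d 0

theorem mulVec_mem_juntaSpan {R : Type*} [Fintype R] {M : Finset ℕ → Matrix R R ℂ}
    {v : Finset ℕ → R → ℂ} {d e : ℕ} (hM : ∀ i j, (fun S => M S i j) ∈ juntaSpan d)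
    (hv : ∀ i, (fun S => v S i) ∈ juntaSpan e) (i : R) :
    (fun S => (M S).mulVec (v S) i) ∈ juntaSpan (d + e) :=
  sum_mem_juntaSpan _ fun j _ => mul_mem_juntaSpan (hM i j) (hv j)

variable {Q : Type} [Fintype Q] [DecidableEq Q]

/-- If the oracle has entries of junta degree `d`, so has the state after `k` queries of junta
degree `k * d`. -/
theorem QueryAlgorithm.state_mem_juntaSpan (A : QueryAlgorithm Q) {M : Finset ℕ → Matrix Q Q ℂ}
    {d : ℕ} (hM : ∀ i j, (fun S => M S i j) ∈ juntaSpan d) (k : ℕ) (b : (Q × Fin 3) × Fin A.w) :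
    (fun S => A.state (M S) k b) ∈ juntaSpan (k * d) := by
  induction k generalizing b with
  | zero => exact const_mem_juntaSpan _ _
  | succ k ih =>
    -- Degree `0` for the input-independent unitary, `d` for the new query.
    rw [show (k + 1) * d = 0 + (d + k * d) by ring]
    refine mulVec_mem_juntaSpan (M := fun _ => (A.U (k + 1)).1)
      (fun i j => const_mem_juntaSpan 0 ((A.U (k + 1)).1 i j))
      (fun c => mulVec_mem_juntaSpan
        (M := fun S => (controlled (M S)).kronecker (1 : Matrix (Fin A.w) (Fin A.w) ℂ))
        (fun i j => ?_) ih c) b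
    exact mul_mem_juntaSpan (e := 0) (controlled_mem_juntaSpan hM i.1 j.1)
      (const_mem_juntaSpan 0 ((1 : Matrix (Fin A.w) (Fin A.w) ℂ) i.2 j.2))

/-- A squared modulus is an amplitude times its conjugate, which doubles the degree. -/
theorem QueryAlgorithm.acceptProb_mem_juntaSpan (A : QueryAlgorithm Q)
    {M : Finset ℕ → Matrix Q Q ℂ} {d : ℕ} (hM : ∀ i j, (fun S => M S i j) ∈ juntaSpan d) :
    (fun S => (A.acceptProb (M S) : ℂ)) ∈ juntaSpan (A.queries * d + A.queries * d) := by
  have h : ∀ S, (A.acceptProb (M S) : ℂ) = ∑ b ∈ A.accept,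
      A.state (M S) A.queries b * star (A.state (M S) A.queries b) := by
    intro S
    simp [acceptProb, Complex.mul_conj']
  simp only [h]
  exact sum_mem_juntaSpan _ fun b _ => mul_mem_juntaSpan (A.state_mem_juntaSpan hM _ b)
    (conj_mem_juntaSpan (A.state_mem_juntaSpan hM _ b))

/-! ### Ladders with crossings -/

/-- The ladder with the columns `{2 c, 2 c + 1}`, in which the two edges between the columns
`c` and `c + 1` are crossed if and only if `c ∈ S`. -/
def ladder (n : ℕ) (S : Finset ℕ) : SimpleGraph (Fin n) where
  Adj u v := ((u : ℕ) / 2 + 1 = v / 2 ∧ ((u : ℕ) / 2 ∈ S ↔ (u : ℕ) % 2 ≠ v % 2)) ∨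
    ((v : ℕ) / 2 + 1 = u / 2 ∧ ((v : ℕ) / 2 ∈ S ↔ (v : ℕ) % 2 ≠ u % 2))
  symm := ⟨fun _ _ h => h.symm⟩
  loopless := ⟨fun u h => by omega⟩

theorem ladder_adj {n : ℕ} {S : Finset ℕ} {u v : Fin n} : (ladder n S).Adj u v ↔
    ((u : ℕ) / 2 + 1 = v / 2 ∧ ((u : ℕ) / 2 ∈ S ↔ (u : ℕ) % 2 ≠ v % 2)) ∨
    ((v : ℕ) / 2 + 1 = u / 2 ∧ ((v : ℕ) / 2 ∈ S ↔ (v : ℕ) % 2 ≠ u % 2)) :=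
  Iff.rfl

/-- The two bits that determine the neighbourhood of `u` in a ladder. -/
def ladderBits (u : ℕ) : Finset ℕ := {u / 2 - 1, u / 2}

theorem card_ladderBits_le (u : ℕ) : (ladderBits u).card ≤ 2 := Finset.card_le_two

/-- Edges at `u` lie in the gaps just before and just after its column. In column 0 the truncated `u
/ 2 - 1` merely repeats bit 0. -/
theorem nbhd_ladder_inter {n : ℕ} (S : Finset ℕ) (u : Fin n) :
    nbhd (ladder n S) u = nbhd (ladder n (S ∩ ladderBits u)) u := by
  ext v
  simp only [nbhd, SimpleGraph.mem_neighborFinset, ladder_adj, Finset.mem_inter]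
  have h₁ : (u : ℕ) / 2 ∈ ladderBits u := by simp [ladderBits]
  have h₂ : (v : ℕ) / 2 + 1 = u / 2 → (v : ℕ) / 2 ∈ ladderBits u := by
    intro h
    simp [ladderBits, ← h]
  tauto

/-- The previous column of a ladder contains a neighbour. -/
theorem exists_ladder_adj_prev {n : ℕ} (S : Finset ℕ) (v : Fin n) {c : ℕ} (hv : (v : ℕ) / 2 = c + 1) :
    ∃ u : Fin n, (u : ℕ) / 2 = c ∧ (ladder n S).Adj u v := by
  by_cases hc : c ∈ S
  · refine ⟨⟨2 * c + (1 - v % 2), by omega⟩, by simp only; omega, Or.inl ⟨by simp only; omega, ?_⟩⟩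
    have : (2 * c + (1 - (v : ℕ) % 2)) / 2 = c := by omega
    simp only [this, hc, true_iff]
    omega
  · refine ⟨⟨2 * c + v % 2, by omega⟩, by simp only; omega, Or.inl ⟨by simp only; omega, ?_⟩⟩
    have : (2 * c + (v : ℕ) % 2) / 2 = c := by omega
    simp only [this, hc, false_iff]
    omega

theorem nbhd_ladder_nonempty {n : ℕ} (hn : 4 ≤ n) (S : Finset ℕ) (u : Fin n) :
    (nbhd (ladder n S) u).Nonempty := by
  suffices ∃ v, (ladder n S).Adj u v by
    obtain ⟨v, hv⟩ := this
    exact ⟨v, by simpa [nbhd] using hv⟩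
  rcases Nat.eq_zero_or_pos ((u : ℕ) / 2) with hu | hu
  · by_cases h0 : 0 ∈ S
    -- Here `u` is 0 or 1, so `3 - u` is the vertex of column 1 in the opposite row; `4 ≤ n` makes
    -- that column full.
    · refine ⟨⟨3 - u, by omega⟩, Or.inl ⟨by simp only; omega, ?_⟩⟩
      simp only [hu, h0, true_iff]
      omega
    · refine ⟨⟨2 + u, by omega⟩, Or.inl ⟨by simp only; omega, ?_⟩⟩
      simp only [hu, h0, false_iff]
      omega
  · obtain ⟨v, -, hv⟩ := exists_ladder_adj_prev S u (c := u / 2 - 1) (by omega)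
    exact ⟨v, hv.symm⟩

/-- The row of `v`, plus the number of crossings before its column. Its parity identifies the
connected component of `v`. -/
def ladderLabel (S : Finset ℕ) (v : ℕ) : ℕ := v % 2 + (S.filter (· < v / 2)).card

theorem card_filter_lt_succ (S : Finset ℕ) (c : ℕ) :
    (S.filter (· < c + 1)).card = (S.filter (· < c)).card + if c ∈ S then 1 else 0 := by
  have h : S.filter (· < c + 1) = S.filter (· < c) ∪ S.filter (· = c) := by
    ext x
    simp only [Finset.mem_filter, Finset.mem_union, Nat.lt_succ_iff_lt_or_eq]
    tauto
  rw [h, Finset.card_union_of_disjoint, Finset.filter_eq']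
  · split_ifs <;> simp
  · exact Finset.disjoint_filter.2 fun x _ h₁ h₂ => h₁.ne h₂

/-- Along an edge the row changes exactly when the crossing count goes up by one, so the two changes
cancel modulo 2. -/
theorem even_ladderLabel_iff_of_adj {n : ℕ} {S : Finset ℕ} {u v : Fin n}
    (h : (ladder n S).Adj u v) : Even (ladderLabel S u) ↔ Even (ladderLabel S v) := by
  wlog huv : (u : ℕ) / 2 + 1 = v / 2 generalizing u v with H
  · have := ladder_adj.1 h
    exact (H h.symm (by omega)).symm
  have hS : (u : ℕ) / 2 ∈ S ↔ (u : ℕ) % 2 ≠ v % 2 := by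
    rcases ladder_adj.1 h with h | h
    · exact h.2
    · omega
  rw [ladderLabel, ladderLabel, ← huv, card_filter_lt_succ, Nat.even_iff, Nat.even_iff]
  split_ifs with hc
  · have := hS.1 hc
    omega
  · have := not_not.1 (mt hS.2 hc)
    omega

theorem even_ladderLabel_iff_of_reachable {n : ℕ} {S : Finset ℕ} {u v : Fin n}
    (h : (ladder n S).Reachable u v) : Even (ladderLabel S u) ↔ Even (ladderLabel S v) := by
  obtain ⟨p⟩ := h
  induction p with
  | nil => rfl
  | cons h _ ih => exact (even_ladderLabel_iff_of_adj h).trans ih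

/-- Walking left column by column preserves the parity of the label; in column 0 an even label
forces row 0, which is `s`. -/
theorem ladder_reachable_of_even {n : ℕ} {S : Finset ℕ} {s : Fin n} (hs : (s : ℕ) = 0) (v : Fin n)
    (hv : Even (ladderLabel S v)) : (ladder n S).Reachable s v := by
  obtain ⟨c, hc⟩ : ∃ c, (v : ℕ) / 2 = c := ⟨_, rfl⟩
  induction c generalizing v with
  | zero =>
    rw [ladderLabel, hc, Nat.even_iff] at hv
    simp only [not_lt_zero, Finset.filter_false, Finset.card_empty] at hv
    rw [Fin.ext (show (s : ℕ) = v by omega)]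
  | succ c ih =>
    obtain ⟨u, hu, huv⟩ := exists_ladder_adj_prev S v hc
    exact (ih u ((even_ladderLabel_iff_of_adj huv).2 hv) hu).trans huv.reachable

theorem ladder_reachable_iff {n k : ℕ} {S : Finset ℕ} (hS : S ⊆ Finset.range k) {s t : Fin n}
    (hs : (s : ℕ) = 0) (ht : (t : ℕ) = 2 * k) : (ladder n S).Reachable s t ↔ Even S.card := by
  have hs' : ladderLabel S s = 0 := by simp [ladderLabel, hs]
  have ht' : ladderLabel S t = S.card := by
    rw [ladderLabel, ht, Nat.mul_mod_right, Nat.mul_div_cancel_left k two_pos, zero_add,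
      Finset.filter_true_of_mem fun x hx => Finset.mem_range.1 (hS hx)]
  rw [← ht']
  refine ⟨fun h => (even_ladderLabel_iff_of_reachable h).1 (by simp [hs']),
    ladder_reachable_of_even hs t⟩

/-! ### The lower bound -/

/-- Entries of a matrix that is block diagonal in the vertex, with blocks determined by the vertex
and its neighbourhood, depend on two bits of the ladder. -/
theorem blockDiagonal_ladder_mem_juntaSpan {n : ℕ} {R : Type*}
    (C : Fin n → Finset (Fin n) → Matrix R R ℂ) (i j : R × Fin n) :
    (fun S => Matrix.blockDiagonal (fun u => C u (nbhd (ladder n S) u)) i j) ∈ juntaSpan 2 := by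
  refine mem_juntaSpan (ladderBits i.2) (card_ladderBits_le _) fun S => ?_
  rw [Matrix.blockDiagonal_apply, Matrix.blockDiagonal_apply, nbhd_ladder_inter S i.2]

theorem DecidesUSTCON.exists_le_queries {n : ℕ} (hn : 4 ≤ n)
    {oracle : SimpleGraph (Fin n) → Matrix Q Q ℂ}
    (horacle : ∀ i j, (fun S => oracle (ladder n S) i j) ∈ juntaSpan 2) {ε : ℝ} (hε : ε < 1 / 2)
    {A : Fin n → Fin n → QueryAlgorithm Q} (hA : DecidesUSTCON oracle ε A) :
    ∃ s t : Fin n, n / 2 - 1 ≤ 4 * (A s t).queries := by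
  let s : Fin n := ⟨0, by omega⟩
  -- Row 0 of the last full column; for odd `n` a single extra vertex follows it.
  let t : Fin n := ⟨2 * (n / 2 - 1), by omega⟩
  have hreach : ∀ S ⊆ Finset.range (n / 2 - 1), (ladder n S).Reachable s t ↔ Even S.card :=
    fun S hS => ladder_reachable_iff hS rfl rfl
  have hdec := fun S => hA (ladder n S) (nbhd_ladder_nonempty hn S) s t
  have := le_of_approximates_parity hε ((A s t).acceptProb_mem_juntaSpan horacle)
    (fun S hS h => (hdec S).1 ((hreach S hS).2 h))
    (fun S hS h => (hdec S).2 (mt (hreach S hS).1 h))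
  exact ⟨s, t, by omega⟩

theorem DecidesUSTCON.exists_linear_le_queries {n : ℕ} (hn : 6 ≤ n)
    {oracle : SimpleGraph (Fin n) → Matrix Q Q ℂ}
    (horacle : ∀ i j, (fun S => oracle (ladder n S) i j) ∈ juntaSpan 2) {ε : ℝ} (hε : ε < 1 / 2)
    {A : Fin n → Fin n → QueryAlgorithm Q} (hA : DecidesUSTCON oracle ε A) :
    ∃ s t : Fin n, 1 / 16 * (n : ℝ) ≤ ((A s t).queries : ℝ) := by
  obtain ⟨s, t, h⟩ := hA.exists_le_queries (by omega) horacle hε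
  refine ⟨s, t, ?_⟩
  -- The bound gives `n ≤ 8 * q + 3`, and `6 ≤ n` forces `q ≥ 1`, so the additive 3 is absorbed.
  have h' : (n : ℝ) ≤ 16 * ((A s t).queries : ℝ) := by
    exact_mod_cast (show n ≤ 16 * (A s t).queries by omega)
  linarith

theorem WalkOracle.query_ladder_mem_juntaSpan {n : ℕ} (O : WalkOracle n)
    (i j : Option (Fin n) × Fin n) : (fun S => O.query (ladder n S) i j) ∈ juntaSpan 2 :=
  blockDiagonal_ladder_mem_juntaSpan O.op i j

theorem SortedArrayOracle.query_ladder_mem_juntaSpan {n : ℕ} (O : SortedArrayOracle n)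
    (i j : (Fin (n + 1) × Fin n) ⊕ ((Fin (n + 1) × Option (Fin n)) × Fin n)) :
    (fun S => O.query (ladder n S) i j) ∈ juntaSpan 2 := by
  rcases i with i | i <;> rcases j with j | j
  · exact blockDiagonal_ladder_mem_juntaSpan O.degOp i j
  · exact const_mem_juntaSpan 2 0
  · exact const_mem_juntaSpan 2 0
  · exact blockDiagonal_ladder_mem_juntaSpan O.nbrOp i j

end QuantumUSTCON

theorem mainTheorem4 (ε : ℝ) (hε : ε < 1 / 2) :
    ∃ c : ℝ, 0 < c ∧ ∃ n₀ : ℕ, ∀ n : ℕ, n₀ ≤ n →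
      (∀ (O : QuantumUSTCON.SortedArrayOracle n)
        (A : Fin n → Fin n → QuantumUSTCON.QueryAlgorithm
          ((Fin (n + 1) × Fin n) ⊕ ((Fin (n + 1) × Option (Fin n)) × Fin n))),
        QuantumUSTCON.DecidesUSTCON O.query ε A →
          ∃ s t : Fin n, c * (n : ℝ) ≤ ((A s t).queries : ℝ)) ∧
      (∀ (O : QuantumUSTCON.WalkOracle n)
        (A : Fin n → Fin n → QuantumUSTCON.QueryAlgorithm (Option (Fin n) × Fin n)),
        QuantumUSTCON.DecidesUSTCON O.query ε A →
          ∃ s t : Fin n, c * (n : ℝ) ≤ ((A s t).queries : ℝ)) := by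
  refine ⟨1 / 16, by norm_num, 6, fun n hn => ⟨fun O A hA => ?_, fun O A hA => ?_⟩⟩
  · exact hA.exists_linear_le_queries hn O.query_ladder_mem_juntaSpan hε
  · exact hA.exists_linear_le_queries hn O.query_ladder_mem_juntaSpan hε
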